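/- Let $\mathbb{K}$ be $\mathbb{R}$ or $\mathbb{C}$, let $n\ge 3$, and let $\mathfrak{r}_{2n+2}$ be the solvable Lie algebra over $\mathbb{K}$ with basis $X_1,\dots,X_{2n},Y_1,Y_2$ whose nonzero brackets are, up to antisymmetry, $$[X_1,X_k]=X_{k+1}\ (2\le k\le 2n-2),\qquad [X_k,X_{2n+1-k}]=(-1)^kX_{2n}\ (2\le k\le n),$$ $$[Y_1,X_k]=kX_k\ (1\le k\le 2n-1),\quad [Y_1,X_{2n}]=(2n+1)X_{2n},\quad [Y_2,X_k]=X_k\ (2\le k\le 2n-1),\quad [Y_2,X_{2n}]=2X_{2n}.$$ For a Lie algebra $\mathfrak{g}$ with basis $Z_1,\dots,Z_N$ and structure constants $[Z_i,Z_j]=\sum_k C_{ij}^kZ_k$, a generalized Casimir invariant on an open set $U\subseteq\mathfrak{g}^*$ is a smooth (holomorphic if $\mathbb{K}=\mathbb{C}$) function $F$ on $U$ with $\widehat{Z}_iF=-\sum_{j,k}C_{ij}^kx_k\,\partial F/\partial x_j=0$ for all $i$, and $\mathcal{N}(\mathfrak{g})$ is the maximal number of functionally independent invariants (invariants with linearly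 independent differentials at each point of some common nonempty open set). Then $\mathfrak{r}_{2n+2}$ has no generalized Casimir invariants: $\mathcal{N}(\mathfrak{r}_{2n+2})=0$, and every invariant on a connected open subset of $\mathfrak{r}_{2n+2}^*$ is constant. Moreover, let $\omega_1,\dots,\omega_{2n},\theta_1,\theta_2$ be the dual basis and, for a 1-form $\alpha$, let $d\alpha(x,y)=-\alpha([x,y])$. Then the 2-form $\xi=d\omega_1+d\omega_{2n}$ satisfies $\bigwedge^{n+1}\xi\neq 0$, and $\xi$ is an exact symplectic form on $\mathfrak{r}_{2n+2}$, i.e. it is closed, nondegenerate, and of the form $d\alpha$ for a 1-form $\alpha$. -/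

import Mathlib

noncomputable section

/-! ### Invariants of a finite-dimensional Lie algebra -/

section Invariants

variable {𝕜 : Type*} [RCLike 𝕜] {L : Type*} [LieRing L] [LieAlgebra 𝕜 L]
  {ι : Type*} [Fintype ι]

/-- The structure constant `C_{ij}^k` of `L` over the basis `b`: `[b i, b j] = ∑ k, C_{ij}^k • b k`. -/
def structConst (b : Module.Basis ι 𝕜 L) (i j k : ι) : 𝕜 :=
  b.repr ⁅b i, b j⁆ k

/-- The vector field `X̂ᵢ = - ∑_{j,k} C_{ij}^k x_k ∂/∂x_j` on the dual space of `L`, applied to the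
function `F` at the point `x`. The linear form `x` is given by its coordinates `x k = x (b k)`. -/
def coadjointField [DecidableEq ι] (b : Module.Basis ι 𝕜 L) (i : ι) (F : (ι → 𝕜) → 𝕜)
    (x : ι → 𝕜) : 𝕜 :=
  -∑ j, ∑ k, structConst b i j k * x k * fderiv 𝕜 F x (Pi.single j 1)

/-- `F` is a (generalized Casimir) invariant of `L` on the open set `U` of the dual space: it is
smooth (holomorphic if `𝕜 = ℂ`) on `U` and solves the system `X̂ᵢ F = 0` there. -/
structure IsInvariantOn [DecidableEq ι] (b : Module.Basis ι 𝕜 L) (U : Set (ι → 𝕜))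
    (F : (ι → 𝕜) → 𝕜) : Prop where
  smooth : ContDiffOn 𝕜 (⊤ : ℕ∞) F U
  eq_zero : ∀ i, ∀ x ∈ U, coadjointField b i F x = 0

/-- `L` has `m` functionally independent invariants: on some nonempty open set of the dual space
there are `m` invariants whose differentials are linearly independent. -/
def HasIndepInvariants [DecidableEq ι] (b : Module.Basis ι 𝕜 L) (m : ℕ) : Prop :=
  ∃ U : Set (ι → 𝕜), IsOpen U ∧ U.Nonempty ∧ ∃ F : Fin m → (ι → 𝕜) → 𝕜,
    (∀ r, IsInvariantOn b U (F r)) ∧ ∀ x ∈ U, LinearIndependent 𝕜 fun r => fderiv 𝕜 (F r) x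

/-- The number of invariants of `L`: the largest number of functionally independent invariants. -/
def numInvariants [DecidableEq ι] (b : Module.Basis ι 𝕜 L) : ℕ∞ :=
  ⨆ m ∈ {m : ℕ | HasIndepInvariants b m}, (m : ℕ∞)

end Invariants

/-! ### Left-invariant differential forms -/

section Forms

variable {𝕜 : Type*} [Field 𝕜] {L : Type*} [LieRing L] [LieAlgebra 𝕜 L]

/-- The exterior derivative of a 1-form `α` on `L`, i.e. the 2-form `dα (x, y) = - α [x, y]`. -/
def extDeriv₁ (α : Module.Dual 𝕜 L) : LinearMap.BilinForm 𝕜 L :=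
  LinearMap.mk₂ 𝕜 (fun x y => -α ⁅x, y⁆)
    (by intros; simp only [add_lie, map_add]; ring)
    (by intros; simp only [smul_lie, map_smul, smul_neg])
    (by intros; simp only [lie_add, map_add]; ring)
    (by intros; simp only [lie_smul, map_smul, smul_neg])

/-- A symplectic form on `L`: a closed nondegenerate 2-form. -/
structure IsSymplecticForm (ξ : LinearMap.BilinForm 𝕜 L) : Prop where
  isAlt : ξ.IsAlt
  closed : ∀ x y z : L, ξ ⁅x, y⁆ z + ξ ⁅y, z⁆ x + ξ ⁅z, x⁆ y = 0
  nondegenerate : ξ.Nondegenerate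

/-- An exact symplectic form on `L`. -/
def IsExactSymplecticForm (ξ : LinearMap.BilinForm 𝕜 L) : Prop :=
  IsSymplecticForm ξ ∧ ∃ α : Module.Dual 𝕜 L, ξ = extDeriv₁ α

/-- A 2-form `ξ` as the element `1/2 ∑_{i,j} ξ (bᵢ, bⱼ) bⁱ ∧ bʲ` of the exterior algebra of the dual
space, where `bⁱ` is the dual basis. The product of the exterior algebra is the wedge product. -/
def twoFormToExterior {ι : Type*} [Fintype ι] (b : Module.Basis ι 𝕜 L)
    (ξ : LinearMap.BilinForm 𝕜 L) : ExteriorAlgebra 𝕜 (Module.Dual 𝕜 L) :=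
  (2⁻¹ : 𝕜) • ∑ i, ∑ j,
    ξ (b i) (b j) • (ExteriorAlgebra.ι 𝕜 (b.coord i) * ExteriorAlgebra.ι 𝕜 (b.coord j))

end Forms

/-! ### The solvable Lie algebra with basis `X₁, …, X₂ₙ, Y₁, Y₂` -/

/-- Indices of the basis: `Sum.inl k` with `1 ≤ k ≤ 2n` stands for `X_k`, and `Sum.inr 0`,
`Sum.inr 1` stand for `Y₁`, `Y₂`. -/
abbrev SolvIdx (n : ℕ) : Type := ↥(Finset.Icc 1 (2 * n)) ⊕ Fin 2

/-- The underlying vector space of the Lie algebra `𝔯_{2n+2}`. -/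
def SolvAlg (𝕜 : Type*) (n : ℕ) : Type _ := SolvIdx n → 𝕜

namespace SolvAlg

variable {𝕜 : Type*} [Field 𝕜] (n : ℕ)

instance : AddCommGroup (SolvAlg 𝕜 n) := inferInstanceAs (AddCommGroup (SolvIdx n → 𝕜))

instance : Module 𝕜 (SolvAlg 𝕜 n) := inferInstanceAs (Module 𝕜 (SolvIdx n → 𝕜))

variable (𝕜) in
/-- The basis `X₁, …, X₂ₙ, Y₁, Y₂`. -/
def basis : Module.Basis (SolvIdx n) 𝕜 (SolvAlg 𝕜 n) := Pi.basisFun 𝕜 (SolvIdx n)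

/-- The basis vector `X_k`, `1 ≤ k ≤ 2n` (and `0` for other `k`). -/
def X (k : ℕ) : SolvAlg 𝕜 n :=
  if h : k ∈ Finset.Icc 1 (2 * n) then basis 𝕜 n (Sum.inl ⟨k, h⟩) else 0

/-- The basis vectors `Y₁ = Y 0` and `Y₂ = Y 1`. -/
def Y (i : Fin 2) : SolvAlg 𝕜 n := basis 𝕜 n (Sum.inr i)

variable (𝕜) in
/-- The dual basis vector `ω_k`, `1 ≤ k ≤ 2n` (and `0` for other `k`). -/
def dualX (k : ℕ) : Module.Dual 𝕜 (SolvAlg 𝕜 n) :=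
  if h : k ∈ Finset.Icc 1 (2 * n) then (basis 𝕜 n).coord (Sum.inl ⟨k, h⟩) else 0

variable (𝕜) in
/-- The dual basis vectors `θ₁ = dualY 0` and `θ₂ = dualY 1`. -/
def dualY (i : Fin 2) : Module.Dual 𝕜 (SolvAlg 𝕜 n) := (basis 𝕜 n).coord (Sum.inr i)

variable {n} in
/-- The alternating bilinear map `(x, y) ↦ (α x * β y - α y * β x) • v`. For dual basis vectors
`α ≠ β`, dual to `A` and `B`, it is the contribution of the relation `[A, B] = v` to the bracket. -/
def rel (α β : Module.Dual 𝕜 (SolvAlg 𝕜 n)) (v : SolvAlg 𝕜 n) :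
    SolvAlg 𝕜 n →ₗ[𝕜] SolvAlg 𝕜 n →ₗ[𝕜] SolvAlg 𝕜 n :=
  LinearMap.mk₂ 𝕜 (fun x y => (α x * β y - α y * β x) • v)
    (by intros; rw [← add_smul]; congr 1; simp only [map_add]; ring)
    (by intros; rw [← mul_smul]; congr 1; simp only [map_smul, smul_eq_mul]; ring)
    (by intros; rw [← add_smul]; congr 1; simp only [map_add]; ring)
    (by intros; rw [← mul_smul]; congr 1; simp only [map_smul, smul_eq_mul]; ring)

variable (𝕜) in
/-- The bracket of `𝔯_{2n+2}`, given by the relations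
* `[X₁, X_k] = X_{k+1}` for `2 ≤ k ≤ 2n-2`,
* `[X_k, X_{2n+1-k}] = (-1)^k X_{2n}` for `2 ≤ k ≤ n`,
* `[Y₁, X_k] = k X_k` for `1 ≤ k ≤ 2n-1` and `[Y₁, X_{2n}] = (2n+1) X_{2n}`,
* `[Y₂, X_k] = X_k` for `2 ≤ k ≤ 2n-1` and `[Y₂, X_{2n}] = 2 X_{2n}`. -/
def bracketMap : SolvAlg 𝕜 n →ₗ[𝕜] SolvAlg 𝕜 n →ₗ[𝕜] SolvAlg 𝕜 n :=
  (∑ k ∈ Finset.Icc 2 (2 * n - 2), rel (dualX 𝕜 n 1) (dualX 𝕜 n k) (X n (k + 1)))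
  + (∑ k ∈ Finset.Icc 2 n, rel (dualX 𝕜 n k) (dualX 𝕜 n (2 * n + 1 - k)) ((-1 : 𝕜) ^ k • X n (2 * n)))
  + (∑ k ∈ Finset.Icc 1 (2 * n - 1), rel (dualY 𝕜 n 0) (dualX 𝕜 n k) ((k : 𝕜) • X n k))
  + rel (dualY 𝕜 n 0) (dualX 𝕜 n (2 * n)) ((2 * n + 1 : 𝕜) • X n (2 * n))
  + (∑ k ∈ Finset.Icc 2 (2 * n - 1), rel (dualY 𝕜 n 1) (dualX 𝕜 n k) (X n k))
  + rel (dualY 𝕜 n 1) (dualX 𝕜 n (2 * n)) ((2 : 𝕜) • X n (2 * n))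

instance : Bracket (SolvAlg 𝕜 n) (SolvAlg 𝕜 n) := ⟨fun x y => bracketMap 𝕜 n x y⟩

theorem bracket_def (x y : SolvAlg 𝕜 n) : ⁅x, y⁆ = bracketMap 𝕜 n x y := rfl

theorem rel_apply (α β : Module.Dual 𝕜 (SolvAlg 𝕜 n)) (v x y : SolvAlg 𝕜 n) :
    rel α β v x y = (α x * β y - α y * β x) • v := rfl

theorem dualX_X {k l : ℕ} (hk : k ∈ Finset.Icc 1 (2 * n)) :
    dualX 𝕜 n k (X n l) = if k = l then 1 else 0 := by
  unfold dualX X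
  rw [dif_pos hk]
  split_ifs with h1 h2 h2
  · subst h2; simp
  · simp only [Module.Basis.coord_apply, Module.Basis.repr_self]
    rw [Finsupp.single_eq_of_ne]
    simpa using h2
  · subst h2; exact absurd hk h1
  · simp

theorem dualY_X (i : Fin 2) (l : ℕ) : dualY 𝕜 n i (X n l) = 0 := by
  unfold dualY X
  split_ifs <;> simp

theorem ext_coord {x y : SolvAlg 𝕜 n} (h : ∀ k ∈ Finset.Icc 1 (2 * n), dualX 𝕜 n k x = dualX 𝕜 n k y)
    (h' : ∀ i, dualY 𝕜 n i x = dualY 𝕜 n i y) : x = y := by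
  apply (basis 𝕜 n).ext_elem
  rintro (⟨k, hk⟩ | i)
  · have := h k hk
    simpa [dualX, hk, -Finset.mem_Icc] using this
  · exact h' i

theorem dualY_bracket (i : Fin 2) (x y : SolvAlg 𝕜 n) : dualY 𝕜 n i ⁅x, y⁆ = 0 := by
  simp [bracket_def, bracketMap, rel_apply, dualY_X]

/-- Coordinates of the bracket along `X_k`, `1 ≤ k ≤ 2n-1`. -/
theorem dualX_bracket {k : ℕ} (h1 : 1 ≤ k) (h2 : k ≤ 2 * n - 1) (x y : SolvAlg 𝕜 n) :
    dualX 𝕜 n k ⁅x, y⁆ =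
      (if 3 ≤ k then dualX 𝕜 n 1 x * dualX 𝕜 n (k - 1) y - dualX 𝕜 n 1 y * dualX 𝕜 n (k - 1) x else 0)
      + k * (dualY 𝕜 n 0 x * dualX 𝕜 n k y - dualY 𝕜 n 0 y * dualX 𝕜 n k x)
      + (if 2 ≤ k then dualY 𝕜 n 1 x * dualX 𝕜 n k y - dualY 𝕜 n 1 y * dualX 𝕜 n k x else 0) := by
  have hk : k ∈ Finset.Icc 1 (2 * n) := by simp; omega
  have hne : k ≠ 2 * n := by omega
  simp only [bracket_def, bracketMap, LinearMap.add_apply, LinearMap.sum_apply, rel_apply, map_add,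
    map_sum, map_smul, dualX_X n hk, smul_eq_mul, hne, if_false, mul_zero, Finset.sum_const_zero,
    add_zero, mul_ite, mul_one, Finset.sum_ite_eq, Finset.mem_Icc, h1, h2, and_true, if_true]
  congr 1
  congr 1
  · split_ifs with h3
    · rw [Finset.sum_eq_single (k - 1)]
      · rw [if_pos (by omega)]
      · intro j _ hj
        rw [if_neg (by omega)]
      · intro hj
        simp only [Finset.mem_Icc] at hj
        omega
    · apply Finset.sum_eq_zero
      intro j hj
      simp only [Finset.mem_Icc] at hj
      rw [if_neg (by omega)]
  · ring

/-- Coordinate of the bracket along `X_{2n}`. -/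
theorem dualX_bracket_last (hn : 1 ≤ n) (x y : SolvAlg 𝕜 n) :
    dualX 𝕜 n (2 * n) ⁅x, y⁆ =
      (∑ k ∈ Finset.Icc 2 n, (-1 : 𝕜) ^ k *
        (dualX 𝕜 n k x * dualX 𝕜 n (2 * n + 1 - k) y - dualX 𝕜 n k y * dualX 𝕜 n (2 * n + 1 - k) x))
      + (2 * n + 1) * (dualY 𝕜 n 0 x * dualX 𝕜 n (2 * n) y - dualY 𝕜 n 0 y * dualX 𝕜 n (2 * n) x)
      + 2 * (dualY 𝕜 n 1 x * dualX 𝕜 n (2 * n) y - dualY 𝕜 n 1 y * dualX 𝕜 n (2 * n) x) := by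
  have hk : 2 * n ∈ Finset.Icc 1 (2 * n) := by simp; omega
  simp only [bracket_def, bracketMap, LinearMap.add_apply, LinearMap.sum_apply, rel_apply, map_add,
    map_sum, map_smul, dualX_X n hk, smul_eq_mul, if_true, mul_one, mul_ite, mul_zero,
    Finset.sum_ite_eq, Finset.mem_Icc]
  rw [if_neg (by omega), if_neg (by omega), Finset.sum_eq_zero]
  · simp only [zero_add, add_zero]
    congr 1
    · congr 1
      · exact Finset.sum_congr rfl fun _ _ => mul_comm _ _
      · ring
    · ring
  · intro j hj
    simp only [Finset.mem_Icc] at hj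
    rw [if_neg (by omega)]

/-- Auxiliary bilinear expression for the Jacobi identity. -/
def pairing (n : ℕ) (u v : ℕ → 𝕜) : 𝕜 :=
  ∑ k ∈ Finset.Icc 2 (2 * n - 1), (-1 : 𝕜) ^ k * (u k * v (2 * n + 1 - k))

theorem sign_reflect {n k : ℕ} (hk : k ≤ 2 * n) : (-1 : 𝕜) ^ (2 * n + 1 - k) = -(-1 : 𝕜) ^ k := by
  have h1 : (-1 : 𝕜) ^ (2 * n + 1 - k) * (-1 : 𝕜) ^ k = -1 := by
    rw [← pow_add, show 2 * n + 1 - k + k = 2 * n + 1 by omega, pow_succ, pow_mul]; simp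
  have h2 : (-1 : 𝕜) ^ k * (-1 : 𝕜) ^ k = 1 := by rw [← mul_pow]; simp
  calc _ = (-1 : 𝕜) ^ (2 * n + 1 - k) * ((-1 : 𝕜) ^ k * (-1 : 𝕜) ^ k) := by rw [h2, mul_one]
    _ = _ := by rw [← mul_assoc, h1]; ring

theorem pairing_reflect (u v : ℕ → 𝕜) :
    pairing n u v = -pairing n v u := by
  unfold pairing
  rw [← Finset.sum_neg_distrib]
  apply Finset.sum_nbij' (fun k => 2 * n + 1 - k) (fun k => 2 * n + 1 - k)
  · intro k hk; simp only [Finset.mem_Icc] at hk ⊢; omega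
  · intro k hk; simp only [Finset.mem_Icc] at hk ⊢; omega
  · intro k hk; simp only [Finset.mem_Icc] at hk; omega
  · intro k hk; simp only [Finset.mem_Icc] at hk; omega
  · intro k hk
    simp only [Finset.mem_Icc] at hk
    have e : 2 * n + 1 - (2 * n + 1 - k) = k := by omega
    rw [e, sign_reflect (by omega)]; ring

theorem sum_eq_pairing (u v : ℕ → 𝕜) :
    (∑ k ∈ Finset.Icc 2 n, (-1 : 𝕜) ^ k * (u k * v (2 * n + 1 - k) - v k * u (2 * n + 1 - k)))
      = pairing n u v := by
  have hs : Finset.Icc 2 (2 * n - 1) = Finset.Icc 2 n ∪ Finset.Icc (n + 1) (2 * n - 1) := by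
    ext k; simp only [Finset.mem_Icc, Finset.mem_union]; omega
  have hd : Disjoint (Finset.Icc 2 n) (Finset.Icc (n + 1) (2 * n - 1)) := by
    rw [Finset.disjoint_left]; intro k; simp only [Finset.mem_Icc]; omega
  unfold pairing
  rw [hs, Finset.sum_union hd]
  have : (∑ k ∈ Finset.Icc (n + 1) (2 * n - 1), (-1 : 𝕜) ^ k * (u k * v (2 * n + 1 - k)))
      = ∑ k ∈ Finset.Icc 2 n, -((-1 : 𝕜) ^ k * (v k * u (2 * n + 1 - k))) := by
    apply Finset.sum_nbij' (fun k => 2 * n + 1 - k) (fun k => 2 * n + 1 - k)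
    · intro k hk; simp only [Finset.mem_Icc] at hk ⊢; omega
    · intro k hk; simp only [Finset.mem_Icc] at hk ⊢; omega
    · intro k hk; simp only [Finset.mem_Icc] at hk; omega
    · intro k hk; simp only [Finset.mem_Icc] at hk; omega
    · intro k hk
      simp only [Finset.mem_Icc] at hk
      have e : 2 * n + 1 - (2 * n + 1 - k) = k := by omega
      rw [e, sign_reflect (by omega)]; ring
  rw [this, ← Finset.sum_add_distrib]
  exact Finset.sum_congr rfl fun _ _ => by ring

theorem pairing_shift (u v : ℕ → 𝕜) :
    pairing n u (fun k => if 3 ≤ k then v (k - 1) else 0)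
      = -pairing n (fun k => if 3 ≤ k then u (k - 1) else 0) v := by
  unfold pairing
  rw [← Finset.sum_neg_distrib]
  have h1 : ∀ f : ℕ → 𝕜, (∀ k ∈ Finset.Icc 2 (2 * n - 1), 2 * n - 1 ≤ k → f k = 0) →
      ∑ k ∈ Finset.Icc 2 (2 * n - 1), f k = ∑ k ∈ Finset.Icc 2 (2 * n - 2), f k := by
    intro f hf
    symm
    apply Finset.sum_subset
    · intro k; simp only [Finset.mem_Icc]; omega
    · intro k hk hk'
      apply hf k hk
      simp only [Finset.mem_Icc] at hk hk'; omega
  have h2 : ∀ f : ℕ → 𝕜, (∀ k ∈ Finset.Icc 2 (2 * n - 1), k ≤ 2 → f k = 0) →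
      ∑ k ∈ Finset.Icc 2 (2 * n - 1), f k = ∑ k ∈ Finset.Icc 3 (2 * n - 1), f k := by
    intro f hf
    symm
    apply Finset.sum_subset
    · intro k; simp only [Finset.mem_Icc]; omega
    · intro k hk hk'
      apply hf k hk
      simp only [Finset.mem_Icc] at hk hk'; omega
  rw [h1, h2]
  · apply Finset.sum_nbij' (fun k => k + 1) (fun k => k - 1)
    · intro k hk; simp only [Finset.mem_Icc] at hk ⊢; omega
    · intro k hk; simp only [Finset.mem_Icc] at hk ⊢; omega
    · intro k hk; simp only [Finset.mem_Icc] at hk; omega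
    · intro k hk; simp only [Finset.mem_Icc] at hk; omega
    · intro k hk
      simp only [Finset.mem_Icc] at hk
      beta_reduce
      rw [if_pos (by omega), if_pos (by omega),
        show 2 * n + 1 - k - 1 = 2 * n + 1 - (k + 1) by omega, show k + 1 - 1 = k by omega, pow_succ]
      ring
  · intro k hk hk'
    simp only [Finset.mem_Icc] at hk
    beta_reduce
    rw [if_neg (by omega)]; simp
  · intro k hk hk'
    simp only [Finset.mem_Icc] at hk
    beta_reduce
    rw [if_neg (by omega)]; simp

theorem pairing_weight (u v : ℕ → 𝕜) :
    pairing n u (fun k => (k : 𝕜) * v k) + pairing n (fun k => (k : 𝕜) * u k) v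
      = (2 * n + 1) * pairing n u v := by
  unfold pairing
  rw [← Finset.sum_add_distrib, Finset.mul_sum]
  apply Finset.sum_congr rfl
  intro k hk
  simp only [Finset.mem_Icc] at hk
  have : ((2 * n + 1 - k : ℕ) : 𝕜) = 2 * n + 1 - k := by
    rw [Nat.cast_sub (by omega)]; push_cast; ring
  beta_reduce
  rw [this]; ring

/-- The coordinates `x_k` as a function of `k`. -/
def co (x : SolvAlg 𝕜 n) (k : ℕ) : 𝕜 := dualX 𝕜 n k x

theorem pairing_bracket (u : ℕ → 𝕜) (x y : SolvAlg 𝕜 n) :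
    pairing n u (co n ⁅x, y⁆) =
      dualX 𝕜 n 1 x * pairing n u (fun k => if 3 ≤ k then co n y (k - 1) else 0)
      - dualX 𝕜 n 1 y * pairing n u (fun k => if 3 ≤ k then co n x (k - 1) else 0)
      + dualY 𝕜 n 0 x * pairing n u (fun k => (k : 𝕜) * co n y k)
      - dualY 𝕜 n 0 y * pairing n u (fun k => (k : 𝕜) * co n x k)
      + dualY 𝕜 n 1 x * pairing n u (co n y) - dualY 𝕜 n 1 y * pairing n u (co n x) := by
  unfold pairing
  simp only [Finset.mul_sum, ← Finset.sum_add_distrib, ← Finset.sum_sub_distrib]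
  apply Finset.sum_congr rfl
  intro k hk
  simp only [Finset.mem_Icc] at hk
  simp only [co]
  rw [dualX_bracket n (by omega) (by omega), if_pos (show 2 ≤ 2 * n + 1 - k by omega)]
  split_ifs <;> ring

theorem dualX_bracket_last' (hn : 1 ≤ n) (x y : SolvAlg 𝕜 n) :
    dualX 𝕜 n (2 * n) ⁅x, y⁆ = pairing n (co n x) (co n y)
      + (2 * n + 1) * (dualY 𝕜 n 0 x * dualX 𝕜 n (2 * n) y - dualY 𝕜 n 0 y * dualX 𝕜 n (2 * n) x)
      + 2 * (dualY 𝕜 n 1 x * dualX 𝕜 n (2 * n) y - dualY 𝕜 n 1 y * dualX 𝕜 n (2 * n) x) := by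
  rw [dualX_bracket_last n hn, ← sum_eq_pairing]
  rfl

theorem jacobi (x y z : SolvAlg 𝕜 n) : ⁅x, ⁅y, z⁆⁆ = ⁅⁅x, y⁆, z⁆ + ⁅y, ⁅x, z⁆⁆ := by
  apply ext_coord
  · intro k hk
    simp only [Finset.mem_Icc] at hk
    rw [map_add]
    by_cases hl : k = 2 * n
    · subst hl
      have hn : 1 ≤ n := by omega
      rw [dualX_bracket_last' n hn x ⁅y, z⁆, dualX_bracket_last' n hn ⁅x, y⁆ z,
        dualX_bracket_last' n hn y ⁅x, z⁆,
        pairing_reflect n (co n ⁅x, y⁆) (co n z)]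
      simp only [pairing_bracket, dualY_bracket, dualX_bracket_last' n hn]
      have a1 := pairing_shift n (co n x) (co n y)
      have a2 := pairing_shift n (co n x) (co n z)
      have a3 := pairing_shift n (co n y) (co n z)
      have b1 := pairing_weight n (co n x) (co n y)
      have b2 := pairing_weight n (co n x) (co n z)
      have b3 := pairing_weight n (co n y) (co n z)
      have c1 := pairing_reflect n (co n x) (co n y)
      have c2 := pairing_reflect n (co n x) (co n z)
      have c3 := pairing_reflect n (co n y) (co n z)
      rw [pairing_reflect n (fun k => if 3 ≤ k then _ else _) _] at a1 a2 a3
      rw [pairing_reflect n (fun k => (k : 𝕜) * _) _] at b1 b2 b3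
      rw [neg_neg] at a1 a2 a3
      rw [← sub_eq_add_neg, sub_eq_iff_eq_add] at b1 b2 b3
      rw [a1, a2, a3, b1, b2, b3, c1, c2, c3]
      ring
    · have h1 : 1 ≤ k := by omega
      have h2 : k ≤ 2 * n - 1 := by omega
      simp only [dualX_bracket n h1 h2, dualY_bracket]
      by_cases h3 : 3 ≤ k
      · rw [dualX_bracket n (k := 1) (by omega) (by omega),
          dualX_bracket n (k := 1) (by omega) (by omega),
          dualX_bracket n (k := 1) (by omega) (by omega),
          dualX_bracket n (k := k - 1) (by omega) (by omega),
          dualX_bracket n (k := k - 1) (by omega) (by omega),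
          dualX_bracket n (k := k - 1) (by omega) (by omega)]
        rw [Nat.cast_sub h1]
        simp only [h3, show 2 ≤ k by omega, show 2 ≤ k - 1 by omega, if_true,
          show ¬ (3 ≤ 1) by omega, show ¬ (2 ≤ 1) by omega, if_false]
        split_ifs <;> push_cast <;> ring
      · simp only [h3, if_false]
        split_ifs <;> ring
  · intro i
    simp only [map_add, dualY_bracket, add_zero]

instance : LieRing (SolvAlg 𝕜 n) where
  add_lie x y z := by simp only [bracket_def, map_add, LinearMap.add_apply]
  lie_add x y z := by simp only [bracket_def, map_add]
  lie_self x := by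
    simp only [bracket_def, bracketMap, LinearMap.add_apply, LinearMap.sum_apply, rel_apply,
      sub_self, zero_smul, Finset.sum_const_zero, add_zero]
  leibniz_lie x y z := jacobi n x y z

instance : LieAlgebra 𝕜 (SolvAlg 𝕜 n) where
  lie_smul t x y := by simp only [bracket_def, map_smul]

end SolvAlg

end

noncomputable section

/-! ### Top powers of 2-forms -/

section TopPower

/-! Everything follows from one fact: for `α = ω₁ + ω₂ₙ` the form `dα` is nondegenerate
(`nondegenerate_extDeriv₁_dualX`). It is closed by the Jacobi identity, hence exact symplectic.

Invariants: up to sign, the matrix of `dα` is the Lie–Poisson matrix `lieMatrix` at the point `α` of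
the dual space. Its determinant is polynomial in the point and nonzero at `α`, so it is nonzero on a
dense set (`dense_det_lieMatrix_ne_zero`). Where it is nonzero, the system `X̂ᵢ F = 0` forces `dF =
0`; by continuity `dF = 0` on the whole open set (`IsInvariantOn.fderiv_eq_zero`). So invariants are
constant on connected open sets, and none is independent.

Top power: `dα` is a sum of `n + 1` products `a ∧ b`, which commute and square to zero, so its power
is `(n + 1)!` times the product of all of them. By nondegeneracy the `2n + 2` covectors involved
span the dual space, so their wedge product is nonzero (`twoFormToExterior_pow_ne_zero`). -/

theorem Commute.add_pow_succ_of_mul_self_eq_zero {A : Type*} [Ring A] {p s : A} (h : Commute p s)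
    (hp : p * p = 0) (k : ℕ) : (p + s) ^ (k + 1) = s ^ (k + 1) + (k + 1) • (p * s ^ k) := by
  induction k with
  | zero => simp [add_comm]
  | succ k ih =>
    have h1 : p * s ^ k * p = 0 := by
      rw [mul_assoc, ← (h.pow_right k).eq, ← mul_assoc, hp, zero_mul]
    rw [pow_succ, ih, add_mul, mul_add, mul_add, smul_mul_assoc, smul_mul_assoc, h1, smul_zero,
      zero_add, ← (h.pow_right (k + 1)).eq, ← pow_succ, mul_assoc, ← pow_succ, add_smul (k + 1) 1,
      one_smul]
    abel

/-- Only the square-free monomial survives in the expansion. The vanishing of the next power is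
carried along because the induction step needs it to discard the term without `p 0`. -/
theorem sum_pow_of_mul_self_eq_zero {A : Type*} [Ring A] (m : ℕ) (p : Fin m → A)
    (hc : ∀ i j, Commute (p i) (p j)) (h0 : ∀ i, p i * p i = 0) :
    (∑ i, p i) ^ m = m.factorial • (List.ofFn p).prod ∧ (∑ i, p i) ^ (m + 1) = 0 := by
  induction m with
  | zero => simp
  | succ m ih =>
    obtain ⟨h1, h2⟩ := ih (fun i => p i.succ) (fun i j => hc _ _) fun i => h0 _
    have hs : Commute (p 0) (∑ i : Fin m, p i.succ) :=
      Commute.sum_right _ _ _ fun i _ => hc _ _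
    rw [Fin.sum_univ_succ, hs.add_pow_succ_of_mul_self_eq_zero (h0 0),
      hs.add_pow_succ_of_mul_self_eq_zero (h0 0), pow_succ _ (m + 1), h2, h1]
    constructor
    · rw [zero_add, List.ofFn_succ, List.prod_cons, mul_smul_comm, ← mul_smul, Nat.factorial_succ]
    · simp

variable {𝕜 : Type*} [Field 𝕜] {M : Type*} [AddCommGroup M] [Module 𝕜 M]

theorem ExteriorAlgebra.ι_mul_ι_swap (x y : M) :
    ExteriorAlgebra.ι 𝕜 y * ExteriorAlgebra.ι 𝕜 x =
      -(ExteriorAlgebra.ι 𝕜 x * ExteriorAlgebra.ι 𝕜 y) :=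
  eq_neg_of_add_eq_zero_left (ExteriorAlgebra.ι_add_mul_swap y x)

theorem ExteriorAlgebra.commute_ι_mul_ι (a b c d : M) :
    Commute (ExteriorAlgebra.ι 𝕜 a * ExteriorAlgebra.ι 𝕜 b)
      (ExteriorAlgebra.ι 𝕜 c * ExteriorAlgebra.ι 𝕜 d) := by
  have key : ∀ u : M, Commute (ExteriorAlgebra.ι 𝕜 a * ExteriorAlgebra.ι 𝕜 b)
      (ExteriorAlgebra.ι 𝕜 u) := by
    intro u
    rw [commute_iff_eq, mul_assoc, ExteriorAlgebra.ι_mul_ι_swap u b, mul_neg, ← mul_assoc,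
      ExteriorAlgebra.ι_mul_ι_swap u a, neg_mul, neg_neg, mul_assoc]
  exact (key c).mul_right (key d)

theorem ExteriorAlgebra.ι_mul_ι_mul_self (a b : M) :
    ExteriorAlgebra.ι 𝕜 a * ExteriorAlgebra.ι 𝕜 b *
      (ExteriorAlgebra.ι 𝕜 a * ExteriorAlgebra.ι 𝕜 b) = 0 := by
  rw [mul_assoc, ← mul_assoc (ExteriorAlgebra.ι 𝕜 b), ExteriorAlgebra.ι_mul_ι_swap a b, neg_mul,
    mul_neg, mul_assoc, ExteriorAlgebra.ι_sq_zero, mul_zero, mul_zero, neg_zero]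

/-- The witness is the interleaved family `a 0, b 0, a 1, b 1, …`. Its order is irrelevant later;
only the membership in its range is used. -/
theorem ExteriorAlgebra.exists_ιMulti_eq_prod_ι_mul_ι (m : ℕ) (a b : Fin m → M) :
    ∃ v : Fin (2 * m) → M,
      ExteriorAlgebra.ιMulti 𝕜 (2 * m) v =
        (List.ofFn fun i => ExteriorAlgebra.ι 𝕜 (a i) * ExteriorAlgebra.ι 𝕜 (b i)).prod ∧
      ∀ i, a i ∈ Set.range v ∧ b i ∈ Set.range v := by
  induction m with
  | zero => exact ⟨Fin.elim0, by simp, fun i => i.elim0⟩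
  | succ m ih =>
    obtain ⟨v, h1, h2⟩ := ih (fun i => a i.succ) (fun i => b i.succ)
    refine ⟨(Matrix.vecCons (a 0) (Matrix.vecCons (b 0) v) : Fin (2 * m + 1 + 1) → M), ?_, ?_⟩
    · rw [List.ofFn_succ, List.prod_cons, ← h1]
      refine (ExteriorAlgebra.ιMulti_succ_apply (n := 2 * m + 1) _).trans ?_
      rw [Matrix.tail_cons, ExteriorAlgebra.ιMulti_succ_apply, Matrix.tail_cons,
        Matrix.cons_val_zero, Matrix.cons_val_zero, mul_assoc]
    · refine Fin.cases ⟨⟨0, rfl⟩, ⟨(Fin.succ 0 : Fin (2 * m + 1 + 1)), rfl⟩⟩ fun i => ?_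
      obtain ⟨⟨k, hk⟩, ⟨l, hl⟩⟩ := h2 i
      exact ⟨⟨(k.succ.succ : Fin (2 * m + 1 + 1)), hk⟩, ⟨(l.succ.succ : Fin (2 * m + 1 + 1)), hl⟩⟩

/-- A spanning family of `d` vectors is a basis, and its determinant extends to a linear functional
on the exterior algebra with value 1 on the wedge product. -/
theorem ExteriorAlgebra.ιMulti_ne_zero_of_span_eq_top {d : ℕ} {v : Fin d → M}
    (hd : Module.finrank 𝕜 M = d) (hv : Submodule.span 𝕜 (Set.range v) = ⊤) :
    ExteriorAlgebra.ιMulti 𝕜 d v ≠ 0 := by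
  have hli : LinearIndependent 𝕜 v :=
    linearIndependent_of_top_le_span_of_card_eq_finrank hv.ge (by simp [hd])
  set e := Module.Basis.mk hli hv.ge with he
  have hev : (e : Fin d → M) = v := Module.Basis.coe_mk _ _
  intro h
  -- The lift takes an alternating map in every degree: the determinant in degree `d`, zero
  -- elsewhere.
  let f : ∀ i : ℕ, M [⋀^Fin i]→ₗ[𝕜] 𝕜 :=
    fun i => if hi : i = d then hi ▸ e.det else 0
  have hf : f d = e.det := by simp [f]
  have h1 := ExteriorAlgebra.liftAlternating_apply_ιMulti f v
  rw [h, map_zero, hf, ← hev, Module.Basis.det_self] at h1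
  exact zero_ne_one h1

variable {L : Type*} [LieRing L] [LieAlgebra 𝕜 L] {ι : Type*} [Fintype ι]

/-- The double sum produces `a ∧ b - b ∧ a = 2 (a ∧ b)` for each pair, and the factor `1/2` cancels
the 2. -/
theorem twoFormToExterior_eq_sum [CharZero 𝕜] (e : Module.Basis ι 𝕜 L)
    {ξ : LinearMap.BilinForm 𝕜 L} {m : ℕ} {a b : Fin m → Module.Dual 𝕜 L}
    (hξ : ∀ x y, ξ x y = ∑ r, (a r x * b r y - a r y * b r x)) :
    twoFormToExterior e ξ =
      ∑ r, ExteriorAlgebra.ι 𝕜 (a r) * ExteriorAlgebra.ι 𝕜 (b r) := by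
  classical
  have hexp : ∀ c : Module.Dual 𝕜 L, ExteriorAlgebra.ι 𝕜 c =
      ∑ i, c (e i) • ExteriorAlgebra.ι 𝕜 (e.coord i) := by
    intro c
    conv_lhs => rw [← e.sum_dual_apply_smul_coord c]
    simp only [map_sum, map_smul]
  have hmul : ∀ c d : Module.Dual 𝕜 L, ExteriorAlgebra.ι 𝕜 c * ExteriorAlgebra.ι 𝕜 d =
      ∑ i, ∑ j, (c (e i) * d (e j)) •
        (ExteriorAlgebra.ι 𝕜 (e.coord i) * ExteriorAlgebra.ι 𝕜 (e.coord j)) := by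
    intro c d
    conv_lhs => rw [hexp c, hexp d, Finset.sum_mul_sum]
    simp only [smul_mul_smul_comm]
  have h2 : ∑ i, ∑ j, ξ (e i) (e j) •
        (ExteriorAlgebra.ι 𝕜 (e.coord i) * ExteriorAlgebra.ι 𝕜 (e.coord j)) =
      ∑ r, (ExteriorAlgebra.ι 𝕜 (a r) * ExteriorAlgebra.ι 𝕜 (b r) -
        ExteriorAlgebra.ι 𝕜 (b r) * ExteriorAlgebra.ι 𝕜 (a r)) := by
    have hr : ∀ r, ExteriorAlgebra.ι 𝕜 (a r) * ExteriorAlgebra.ι 𝕜 (b r) -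
        ExteriorAlgebra.ι 𝕜 (b r) * ExteriorAlgebra.ι 𝕜 (a r) =
        ∑ i, ∑ j, (a r (e i) * b r (e j) - b r (e i) * a r (e j)) •
          (ExteriorAlgebra.ι 𝕜 (e.coord i) * ExteriorAlgebra.ι 𝕜 (e.coord j)) := fun r => by
      rw [hmul (a r), hmul (b r)]
      simp only [← Finset.sum_sub_distrib, ← sub_smul]
    simp only [hξ, Finset.sum_smul]
    rw [Finset.sum_congr rfl fun r _ => hr r]
    symm
    rw [Finset.sum_comm]
    refine Finset.sum_congr rfl fun i _ => ?_
    rw [Finset.sum_comm]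
    refine Finset.sum_congr rfl fun j _ => Finset.sum_congr rfl fun r _ => ?_
    rw [mul_comm (b r (e i))]
  rw [twoFormToExterior, h2, Finset.smul_sum]
  refine Finset.sum_congr rfl fun r _ => ?_
  rw [ExteriorAlgebra.ι_mul_ι_swap (a r) (b r), sub_neg_eq_add, ← two_smul 𝕜, smul_smul,
    inv_mul_cancel₀ two_ne_zero, one_smul]

theorem twoFormToExterior_pow_ne_zero [CharZero 𝕜] (e : Module.Basis ι 𝕜 L)
    {ξ : LinearMap.BilinForm 𝕜 L} (hnd : ξ.Nondegenerate) {m : ℕ} (hm : Fintype.card ι = 2 * m)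
    {a b : Fin m → Module.Dual 𝕜 L}
    (hξ : ∀ x y, ξ x y = ∑ r, (a r x * b r y - a r y * b r x)) :
    twoFormToExterior e ξ ^ m ≠ 0 := by
  have : FiniteDimensional 𝕜 L := e.finiteDimensional_of_finite
  rw [twoFormToExterior_eq_sum e hξ,
    (sum_pow_of_mul_self_eq_zero m _ (fun i j => ExteriorAlgebra.commute_ι_mul_ι _ _ _ _)
      fun i => ExteriorAlgebra.ι_mul_ι_mul_self _ _).1]
  obtain ⟨v, hv, hab⟩ := ExteriorAlgebra.exists_ιMulti_eq_prod_ι_mul_ι (𝕜 := 𝕜) m a b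
  rw [← hv, ← Nat.cast_smul_eq_nsmul 𝕜]
  refine smul_ne_zero (Nat.cast_ne_zero.2 m.factorial_ne_zero)
    (ExteriorAlgebra.ιMulti_ne_zero_of_span_eq_top ?_ ?_)
  · rw [Subspace.dual_finrank_eq, Module.finrank_eq_card_basis e, hm]
  -- A vector killed by all the covectors `a r`, `b r` lies in the radical of `ξ`, hence is zero; so
  -- these covectors span the dual space.
  · rw [← Subspace.dualCoannihilator_dualAnnihilator_eq (W := Submodule.span 𝕜 (Set.range v)),
      (Submodule.eq_bot_iff (Submodule.span 𝕜 (Set.range v)).dualCoannihilator).2 fun x hx => ?_,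
      Submodule.dualAnnihilator_bot]
    rw [Submodule.mem_dualCoannihilator] at hx
    refine hnd.1 x fun y => ?_
    rw [hξ]
    refine Finset.sum_eq_zero fun r _ => ?_
    rw [hx _ (Submodule.subset_span (hab r).1), hx _ (Submodule.subset_span (hab r).2)]
    ring

end TopPower

/-! ### Invariants vanish to first order when some `dα` is nondegenerate -/

section Invariants

variable {𝕜 : Type*} [RCLike 𝕜] {L : Type*} [LieRing L] [LieAlgebra 𝕜 L]
  {ι : Type*} [Fintype ι]

/-- The matrix `(∑ k, C_{ij}^k x_k)_{ij}` of the Lie–Poisson bracket at the linear form `x`. -/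
def lieMatrix (b : Module.Basis ι 𝕜 L) (x : ι → 𝕜) : Matrix ι ι 𝕜 :=
  Matrix.of fun i j => ∑ k, structConst b i j k * x k

theorem lieMatrix_add_smul (b : Module.Basis ι 𝕜 L) (x y : ι → 𝕜) (s : 𝕜) :
    lieMatrix b (x + s • y) = lieMatrix b x + s • lieMatrix b y := by
  ext i j
  simp only [lieMatrix, Matrix.of_apply, Matrix.add_apply, Matrix.smul_apply, Pi.add_apply,
    Pi.smul_apply, smul_eq_mul, Finset.mul_sum, ← Finset.sum_add_distrib]
  exact Finset.sum_congr rfl fun k _ => by ring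

variable [DecidableEq ι]

theorem coadjointField_eq_mulVec (b : Module.Basis ι 𝕜 L) (i : ι) (F : (ι → 𝕜) → 𝕜) (x : ι → 𝕜) :
    coadjointField b i F x =
      -(lieMatrix b x).mulVec (fun j => fderiv 𝕜 F x (Pi.single j 1)) i := by
  simp only [coadjointField, lieMatrix, Matrix.mulVec, dotProduct, Matrix.of_apply, Finset.sum_mul]

theorem det_lieMatrix_ne_zero (b : Module.Basis ι 𝕜 L) {α : Module.Dual 𝕜 L}
    (hα : (extDeriv₁ α).Nondegenerate) : (lieMatrix b fun k => α (b k)).det ≠ 0 := by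
  have h : LinearMap.BilinForm.toMatrix b (extDeriv₁ α) = -lieMatrix b fun k => α (b k) := by
    ext i j
    rw [LinearMap.BilinForm.toMatrix_apply, Matrix.neg_apply]
    change -α ⁅b i, b j⁆ = _
    conv_lhs => rw [← b.sum_repr ⁅b i, b j⁆]
    simp only [lieMatrix, structConst, Matrix.of_apply, map_sum, map_smul, smul_eq_mul]
  have h1 := (LinearMap.BilinForm.nondegenerate_iff_det_ne_zero b).1 hα
  rw [h, Matrix.det_neg] at h1
  exact right_ne_zero_of_mul h1

theorem fderiv_eq_zero_of_det_ne_zero {b : Module.Basis ι 𝕜 L} {U : Set (ι → 𝕜)}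
    {F : (ι → 𝕜) → 𝕜} (hF : IsInvariantOn b U F) {x : ι → 𝕜} (hx : x ∈ U)
    (hdet : (lieMatrix b x).det ≠ 0) : fderiv 𝕜 F x = 0 := by
  have h : (lieMatrix b x).mulVec (fun j => fderiv 𝕜 F x (Pi.single j 1)) = 0 := by
    ext i
    have := hF.eq_zero i x hx
    rwa [coadjointField_eq_mulVec, neg_eq_zero] at this
  have h2 := Matrix.eq_zero_of_mulVec_eq_zero hdet h
  ext v
  rw [← Finset.univ_sum_single v, map_sum]
  refine Finset.sum_eq_zero fun j _ => ?_
  have : Pi.single j (v j) = v j • (Pi.single j 1 : ι → 𝕜) := by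
    rw [← Pi.single_smul, smul_eq_mul, mul_one]
  rw [this, map_smul, show fderiv 𝕜 F x (Pi.single j 1) = 0 from congrFun h2 j, smul_zero]

/-- On the line from any `x` to `x₀` the determinant is a one-variable polynomial, nonzero at
parameter 1. It has finitely many roots, so points arbitrarily close to `x` avoid them. -/
theorem dense_det_lieMatrix_ne_zero {b : Module.Basis ι 𝕜 L} {x₀ : ι → 𝕜}
    (h₀ : (lieMatrix b x₀).det ≠ 0) : Dense {x | (lieMatrix b x).det ≠ 0} := by
  intro x
  let P : Polynomial 𝕜 := ((lieMatrix b x).map Polynomial.C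
    + (Polynomial.X : Polynomial 𝕜) • (lieMatrix b (x₀ - x)).map Polynomial.C).det
  have hP : ∀ s : 𝕜, P.eval s = (lieMatrix b (x + s • (x₀ - x))).det := by
    intro s
    rw [lieMatrix_add_smul, ← Polynomial.coe_evalRingHom, RingHom.map_det]
    congr 1
    ext i j
    simp [mul_comm s]
  have hP0 : P ≠ 0 := by
    intro h
    have := hP 1
    rw [h, Polynomial.eval_zero, one_smul, add_sub_cancel] at this
    exact h₀ this.symm
  have hev : ∀ᶠ s in nhdsWithin (0 : 𝕜) {0}ᶜ, x + s • (x₀ - x) ∈ {x | (lieMatrix b x).det ≠ 0} := by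
    have h := P.roots.toFinset.finite_toSet
    have h2 : ∀ᶠ s in nhdsWithin (0 : 𝕜) {0}ᶜ, s ∉ (P.roots.toFinset : Set 𝕜) := by
      -- The parameter 0 may itself be a root, so it is removed from the root set and excluded by
      -- the punctured neighbourhood.
      have h3 : ((P.roots.toFinset : Set 𝕜) \ {0})ᶜ ∈ nhds (0 : 𝕜) :=
        (h.subset Set.sdiff_subset).isClosed.isOpen_compl.mem_nhds (by simp)
      filter_upwards [mem_nhdsWithin_of_mem_nhds h3, self_mem_nhdsWithin] with s hs hs0 hs'
      exact hs ⟨hs', hs0⟩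
    filter_upwards [h2] with s hs
    rw [← hP]
    intro h4
    exact hs (by simp [hP0, h4])
  have ht : Filter.Tendsto (fun s : 𝕜 => x + s • (x₀ - x)) (nhdsWithin 0 {0}ᶜ) (nhds x) := by
    have hc : Continuous fun s : 𝕜 => x + s • (x₀ - x) := by fun_prop
    have := hc.tendsto 0
    rw [zero_smul, add_zero] at this
    exact this.mono_left nhdsWithin_le_nhds
  exact mem_closure_of_tendsto ht hev

theorem IsInvariantOn.fderiv_eq_zero {b : Module.Basis ι 𝕜 L} {U : Set (ι → 𝕜)} {F : (ι → 𝕜) → 𝕜}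
    (hF : IsInvariantOn b U F) (hU : IsOpen U) {α : Module.Dual 𝕜 L}
    (hα : (extDeriv₁ α).Nondegenerate) {x : ι → 𝕜} (hx : x ∈ U) : fderiv 𝕜 F x = 0 := by
  have hd := dense_det_lieMatrix_ne_zero (det_lieMatrix_ne_zero b hα)
  have hc : ContinuousOn (fderiv 𝕜 F) U :=
    hF.smooth.continuousOn_fderiv_of_isOpen hU (by exact_mod_cast le_top)
  have hcl : x ∈ closure (U ∩ {x | (lieMatrix b x).det ≠ 0}) :=
    hd.open_subset_closure_inter hU hx
  have := mem_closure_iff_nhdsWithin_neBot.1 hcl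
  refine tendsto_nhds_unique ((hc x hx).mono_left
    (nhdsWithin_mono x (Set.inter_subset_left (t := {x | (lieMatrix b x).det ≠ 0}))))
    (tendsto_const_nhds.congr' ?_)
  filter_upwards [self_mem_nhdsWithin] with y hy
  exact (fderiv_eq_zero_of_det_ne_zero hF hy.1 hy.2).symm

theorem IsInvariantOn.exists_eq_const {b : Module.Basis ι 𝕜 L} {U : Set (ι → 𝕜)}
    {F : (ι → 𝕜) → 𝕜} (hF : IsInvariantOn b U F) (hU : IsOpen U) (hU' : IsPreconnected U)
    {α : Module.Dual 𝕜 L} (hα : (extDeriv₁ α).Nondegenerate) : ∃ c : 𝕜, ∀ x ∈ U, F x = c :=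
  hU.exists_is_const_of_fderiv_eq_zero hU' (hF.smooth.differentiableOn (by simp))
    fun _ hx => hF.fderiv_eq_zero hU hα hx

theorem numInvariants_eq_zero (b : Module.Basis ι 𝕜 L) {α : Module.Dual 𝕜 L}
    (hα : (extDeriv₁ α).Nondegenerate) : numInvariants b = 0 := by
  simp only [numInvariants, ENat.iSup_eq_zero, Nat.cast_eq_zero, Set.mem_ofPred_eq]
  rintro m ⟨U, hU, ⟨x, hx⟩, F, hF, hli⟩
  by_contra hm
  exact (hli x hx).ne_zero ⟨0, Nat.pos_of_ne_zero hm⟩ ((hF _).fderiv_eq_zero hU hα hx)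

end Invariants

/-! ### Exterior derivatives of 1-forms are alternating and closed -/

section Exact

variable {𝕜 : Type*} [Field 𝕜] {L : Type*} [LieRing L] [LieAlgebra 𝕜 L]

theorem extDeriv₁_apply (α : Module.Dual 𝕜 L) (x y : L) : extDeriv₁ α x y = -α ⁅x, y⁆ := rfl

theorem extDeriv₁_add (α β : Module.Dual 𝕜 L) :
    extDeriv₁ (α + β) = extDeriv₁ α + extDeriv₁ β := by
  ext x y
  simp only [LinearMap.add_apply, extDeriv₁_apply]
  ring

theorem extDeriv₁_isAlt (α : Module.Dual 𝕜 L) : (extDeriv₁ α).IsAlt := fun x => by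
  rw [extDeriv₁_apply, lie_self, map_zero, neg_zero]

theorem extDeriv₁_closed (α : Module.Dual 𝕜 L) (x y z : L) :
    extDeriv₁ α ⁅x, y⁆ z + extDeriv₁ α ⁅y, z⁆ x + extDeriv₁ α ⁅z, x⁆ y = 0 := by
  rw [extDeriv₁_apply, extDeriv₁_apply, extDeriv₁_apply, ← neg_add, ← neg_add, ← map_add,
    ← map_add, ← lie_skew ⁅x, y⁆ z, ← lie_skew ⁅y, z⁆ x, ← lie_skew ⁅z, x⁆ y, ← neg_add, ← neg_add,
    ← add_rotate, lie_jacobi, neg_zero, map_zero, neg_zero]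

theorem isExactSymplecticForm_extDeriv₁ {α : Module.Dual 𝕜 L}
    (hα : (extDeriv₁ α).Nondegenerate) : IsExactSymplecticForm (extDeriv₁ α) :=
  ⟨⟨extDeriv₁_isAlt α, extDeriv₁_closed α, hα⟩, α, rfl⟩

end Exact

/-! ### The form `dω₁ + dω₂ₙ` on the solvable Lie algebra -/

namespace SolvAlg

variable {𝕜 : Type*} [Field 𝕜] (n : ℕ)

theorem dualY_Y (i j : Fin 2) : dualY 𝕜 n i (Y n j) = if i = j then 1 else 0 := by
  simp [dualY, Y, Finsupp.single_apply, eq_comm]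

theorem dualX_Y (k : ℕ) (j : Fin 2) : dualX 𝕜 n k (Y n j) = 0 := by
  unfold dualX Y
  split_ifs <;> simp

theorem extDeriv₁_dualX_apply (hn : 3 ≤ n) (x y : SolvAlg 𝕜 n) :
    extDeriv₁ (dualX 𝕜 n 1 + dualX 𝕜 n (2 * n)) x y =
      -(dualY 𝕜 n 0 x * dualX 𝕜 n 1 y - dualY 𝕜 n 0 y * dualX 𝕜 n 1 x
        + (∑ k ∈ Finset.Icc 2 n, (-1 : 𝕜) ^ k *
          (dualX 𝕜 n k x * dualX 𝕜 n (2 * n + 1 - k) y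
            - dualX 𝕜 n k y * dualX 𝕜 n (2 * n + 1 - k) x))
        + (2 * n + 1) * (dualY 𝕜 n 0 x * dualX 𝕜 n (2 * n) y - dualY 𝕜 n 0 y * dualX 𝕜 n (2 * n) x)
        + 2 * (dualY 𝕜 n 1 x * dualX 𝕜 n (2 * n) y - dualY 𝕜 n 1 y * dualX 𝕜 n (2 * n) x)) := by
  rw [extDeriv₁_apply, LinearMap.add_apply, dualX_bracket n le_rfl (by omega),
    dualX_bracket_last n (by omega)]
  simp
  ring

/-- Pairing a radical vector with the basis vectors gives a triangular linear system for its
coordinates, with nonzero pivots `±1` and `±2`. -/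
theorem nondegenerate_extDeriv₁_dualX [CharZero 𝕜] (hn : 3 ≤ n) :
    (extDeriv₁ (dualX 𝕜 n 1 + dualX 𝕜 n (2 * n))).Nondegenerate := by
  have hrefl : LinearMap.IsRefl (extDeriv₁ (dualX 𝕜 n 1 + dualX 𝕜 n (2 * n))) :=
    (extDeriv₁_isAlt _).isRefl
  refine hrefl.nondegenerate_iff_separatingLeft.2 ?_
  intro x hx
  have key : ∀ y, dualY 𝕜 n 0 x * dualX 𝕜 n 1 y - dualY 𝕜 n 0 y * dualX 𝕜 n 1 x
        + pairing n (co n x) (co n y)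
        + (2 * n + 1) * (dualY 𝕜 n 0 x * dualX 𝕜 n (2 * n) y - dualY 𝕜 n 0 y * dualX 𝕜 n (2 * n) x)
        + 2 * (dualY 𝕜 n 1 x * dualX 𝕜 n (2 * n) y - dualY 𝕜 n 1 y * dualX 𝕜 n (2 * n) x) = 0 := by
    intro y
    have := hx y
    rw [extDeriv₁_dualX_apply n hn, neg_eq_zero] at this
    rw [← sum_eq_pairing]
    exact this
  have m1 : 1 ∈ Finset.Icc 1 (2 * n) := by simp; omega
  have m2 : 2 * n ∈ Finset.Icc 1 (2 * n) := by simp; omega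
  have hp : ∀ l ∈ Finset.Icc 1 (2 * n), pairing n (co n x) (co n (X n l)) =
      if l ∈ Finset.Icc 2 (2 * n - 1) then -(-1) ^ l * dualX 𝕜 n (2 * n + 1 - l) x else 0 := by
    intro l hl
    -- Antisymmetry moves `X_l` to the first slot, where its coordinates leave only the term `k =
    -- l`.
    rw [pairing_reflect, pairing, ← Finset.sum_neg_distrib,
      ← Finset.sum_ite_eq (Finset.Icc 2 (2 * n - 1)) l
        fun k => -(-1) ^ k * dualX 𝕜 n (2 * n + 1 - k) x]
    refine Finset.sum_congr rfl fun k hk => ?_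
    rw [Finset.mem_Icc] at hk
    simp only [co]
    rw [dualX_X n (by rw [Finset.mem_Icc]; omega)]
    by_cases h : k = l
    · rw [if_pos h, if_pos h.symm]; ring
    · rw [if_neg h, if_neg (Ne.symm h)]; ring
  have hpY : ∀ j, pairing n (co n x) (co n (Y n j)) = 0 := fun j => by
    simp [pairing, co, dualX_Y]
  -- Testing on `X₁` gives `θ₁(x) = 0`, then `X₂ₙ` gives `θ₂(x) = 0`; `Y₂` gives `ω₂ₙ(x) = 0`, then
  -- `Y₁` gives `ω₁(x) = 0`.
  have a1 := key (X n 1)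
  have a2 := key (X n (2 * n))
  have a3 := key (Y n 0)
  have a4 := key (Y n 1)
  have hp1 := (hp 1 m1).trans (if_neg (by simp))
  have hp2 := (hp (2 * n) m2).trans (if_neg (by simp; omega))
  simp [hp1, dualX_X n m1, dualX_X n m2, dualY_X, show 2 * n ≠ 1 by omega] at a1
  simp [hp2, dualX_X n m1, dualX_X n m2, dualY_X, show 1 ≠ 2 * n by omega] at a2
  simp [hpY, dualX_Y, dualY_Y] at a3 a4
  rw [a1] at a2
  simp at a2
  rw [a4] at a3
  simp at a3
  refine ext_coord n (fun k hk => ?_) (fun i => ?_)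
  · rw [map_zero]
    by_cases h1 : k = 1
    · rw [h1, a3]
    by_cases h2 : k = 2 * n
    · rw [h2, a4]
    rw [Finset.mem_Icc] at hk
    -- For the remaining `k`, the partner of `X_k` under `k ↦ 2n + 1 - k` isolates the coordinate
    -- `ω_k(x)`.
    have a5 := key (X n (2 * n + 1 - k))
    rw [hp _ (by rw [Finset.mem_Icc]; omega), dualX_X n m1, dualX_X n m2,
      if_neg (show ¬ 1 = 2 * n + 1 - k by omega), if_neg (show ¬ 2 * n = 2 * n + 1 - k by omega),
      if_pos (by rw [Finset.mem_Icc]; omega),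
      show 2 * n + 1 - (2 * n + 1 - k) = k by omega] at a5
    simpa [dualY_X] using a5
  · rw [map_zero]
    fin_cases i
    · exact a1
    · exact a2

theorem card_solvIdx : Fintype.card (SolvIdx n) = 2 * (n + 1) := by
  simp [SolvIdx]
  ring

theorem twoFormToExterior_extDeriv₁_dualX_pow_ne_zero [CharZero 𝕜] (hn : 3 ≤ n) :
    twoFormToExterior (basis 𝕜 n) (extDeriv₁ (dualX 𝕜 n 1 + dualX 𝕜 n (2 * n))) ^ (n + 1) ≠ 0 := by
  -- The range `2 ≤ k ≤ n` has `p = n - 1` elements, giving pairs `-(-1)^k ω_k`, `ω_{2n+1-k}` with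
  -- `k = 2 + i`. Collecting the remaining terms by `θ₁` and `θ₂` gives two more pairs: `-θ₁`, `ω₁ +
  -- (2n+1) ω₂ₙ` and `-2θ₂`, `ω₂ₙ`.
  obtain ⟨p, rfl⟩ : ∃ p, n = p + 1 := ⟨n - 1, by omega⟩
  refine twoFormToExterior_pow_ne_zero (basis 𝕜 (p + 1)) (nondegenerate_extDeriv₁_dualX _ hn)
    (card_solvIdx _)
    (a := Matrix.vecCons (-dualY 𝕜 (p + 1) 0) (Matrix.vecCons ((-2 : 𝕜) • dualY 𝕜 (p + 1) 1)
      fun i : Fin p => -(-1 : 𝕜) ^ (2 + (i : ℕ)) • dualX 𝕜 (p + 1) (2 + i)))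
    (b := Matrix.vecCons (dualX 𝕜 (p + 1) 1 +
        (2 * (p + 1 : ℕ) + 1 : 𝕜) • dualX 𝕜 (p + 1) (2 * (p + 1)))
      (Matrix.vecCons (dualX 𝕜 (p + 1) (2 * (p + 1)))
      fun i : Fin p => dualX 𝕜 (p + 1) (2 * (p + 1) + 1 - (2 + i)))) fun x y => ?_
  rw [extDeriv₁_dualX_apply _ hn, Fin.sum_univ_succ, Fin.sum_univ_succ,
    ← Finset.Ico_add_one_right_eq_Icc, Finset.sum_Ico_eq_sum_range,
    show p + 1 + 1 - 2 = p by omega, Finset.sum_range]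
  simp only [Matrix.cons_val_zero, Matrix.cons_val_succ, LinearMap.neg_apply, LinearMap.add_apply,
    LinearMap.smul_apply, smul_eq_mul]
  have h : ∑ i : Fin p, (-1 : 𝕜) ^ (2 + (i : ℕ)) * (dualX 𝕜 (p + 1) (2 + i) x *
      dualX 𝕜 (p + 1) (2 * (p + 1) + 1 - (2 + i)) y - dualX 𝕜 (p + 1) (2 + i) y *
      dualX 𝕜 (p + 1) (2 * (p + 1) + 1 - (2 + i)) x) =
      -∑ i : Fin p, (-(-1 : 𝕜) ^ (2 + (i : ℕ)) * dualX 𝕜 (p + 1) (2 + i) x *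
      dualX 𝕜 (p + 1) (2 * (p + 1) + 1 - (2 + i)) y - -(-1 : 𝕜) ^ (2 + (i : ℕ)) *
      dualX 𝕜 (p + 1) (2 + i) y * dualX 𝕜 (p + 1) (2 * (p + 1) + 1 - (2 + i)) x) := by
    rw [← Finset.sum_neg_distrib]
    exact Finset.sum_congr rfl fun i _ => by ring
  rw [h]
  ring

end SolvAlg

theorem proposition7 {𝕜 : Type*} [RCLike 𝕜] (n : ℕ) (hn : 3 ≤ n) :
    numInvariants (SolvAlg.basis 𝕜 n) = 0 ∧
    (∀ (U : Set (SolvIdx n → 𝕜)) (F : (SolvIdx n → 𝕜) → 𝕜), IsOpen U → IsPreconnected U →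
      IsInvariantOn (SolvAlg.basis 𝕜 n) U F → ∃ c : 𝕜, ∀ x ∈ U, F x = c) ∧
    ∀ ξ : LinearMap.BilinForm 𝕜 (SolvAlg 𝕜 n),
      ξ = extDeriv₁ (SolvAlg.dualX 𝕜 n 1) + extDeriv₁ (SolvAlg.dualX 𝕜 n (2 * n)) →
        twoFormToExterior (SolvAlg.basis 𝕜 n) ξ ^ (n + 1) ≠ 0 ∧ IsExactSymplecticForm ξ := by
  have hnd := SolvAlg.nondegenerate_extDeriv₁_dualX (𝕜 := 𝕜) n hn
  refine ⟨numInvariants_eq_zero _ hnd, fun U F hU hU' hF => hF.exists_eq_const hU hU' hnd, ?_⟩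
  rintro ξ rfl
  rw [← extDeriv₁_add]
  exact ⟨SolvAlg.twoFormToExterior_extDeriv₁_dualX_pow_ne_zero n hn,
    isExactSymplecticForm_extDeriv₁ hnd⟩

end
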